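/- Let $n\ge 1$, let $\tau\in(0,1)$ and $p\in(0,\infty)$, and let $w:\mathbb{R}^n\to[0,\infty)$ be a weight, i.e. a non-negative (Lebesgue) measurable function. Cubes are closed, nondegenerate, with sides parallel to the axes; $|\cdot|$ is Lebesgue measure and $w(Q)=\int_Q w$. For measurable $f:\mathbb{R}^n\to\mathbb{R}$ and a cube $Q$ put $$m^\tau_f(Q)=\sup\{\alpha\ge 0 : |Q\cap\{|f|\ge\alpha\}|\ge\tau|Q|\},\qquad \mathcal{M}^\tau f(x)=\sup_{Q\ni x}m^\tau_f(Q),$$ the last supremum being over all cubes $Q$ containing $x$. Theorem. The operator $\mathcal{M}^\tau$ is bounded on $L^p(w)$ if and only if $w\in A_\infty$. Here "bounded on $L^p(w)$" means that there is a finite constant $C$ such that for every measurable $f:\mathbb{R}^n\to\mathbb{R}$ with $\|f\|_{L^p(w)}=\left(\int|f|^p\,w\,dx\right)^{1/p}<\infty$, one has $\mathcal{M}^\tau f\in L^p(w)$ (in particular it is measurable with respect to the completion of $w\,dx$) and $\|\mathcal{M}^\tau f\|_{L^p(w)}\le C\|f\|_{L^p(w)}$. Further, $A_\infty=\bigcup_{1\le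 q<\infty}A_q$, where $w\in A_1$ if $$\sup_Q\frac{w(Q)}{|Q|}\,\|w^{-1}\|_{L^\infty(Q)}<\infty,$$ and, for $1<q<\infty$, $w\in A_q$ if $$\sup_Q\frac{w(Q)}{|Q|}\left(\frac{1}{|Q|}\int_Q w^{-1/(q-1)}\right)^{q-1}<\infty,$$ the suprema being over all cubes and computed in $[0,\infty]$ with $0^{-1}=0^{-1/(q-1)}=\infty$ and $0\cdot\infty=0$ (a convention that matters only for the weight that vanishes almost everywhere, which satisfies both sides). -/

import Mathlib

open MeasureTheory
open scoped ENNReal NNReal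

noncomputable section

namespace MedianMaximal

/-- Cubes in `ℝⁿ`: closed, nondegenerate, with sides parallel to the coordinate axes. -/
def IsCube {n : ℕ} (Q : Set (Fin n → ℝ)) : Prop :=
  ∃ (a : Fin n → ℝ) (l : ℝ), 0 < l ∧ Q = Set.Icc a (fun i => a i + l)

/-- The measure `w dx` of a weight `w : ℝⁿ → [0, ∞)`. -/
def weightMeasure {n : ℕ} (w : (Fin n → ℝ) → ℝ≥0) : Measure (Fin n → ℝ) :=
  volume.withDensity (fun x => (w x : ℝ≥0∞))

/-- The number `m_f^τ(Q) = sup {α ≥ 0 : |Q ∩ {|f| ≥ α}| / |Q| ≥ τ}`. -/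
def level {n : ℕ} (τ : ℝ) (f : (Fin n → ℝ) → ℝ) (Q : Set (Fin n → ℝ)) : ℝ≥0∞ :=
  ⨆ (α : ℝ≥0) (_ : ENNReal.ofReal τ ≤ volume (Q ∩ {x | (α : ℝ) ≤ |f x|}) / volume Q), (α : ℝ≥0∞)

/-- The maximal operator `𝓜^τ f (x) = sup_{Q ∋ x} m_f^τ(Q)`, with values in `[0, ∞]`. -/
def levelMaximal {n : ℕ} (τ : ℝ) (f : (Fin n → ℝ) → ℝ) (x : Fin n → ℝ) : ℝ≥0∞ :=
  ⨆ (Q : Set (Fin n → ℝ)) (_ : IsCube Q) (_ : x ∈ Q), level τ f Q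

/-- `𝓜^τ` is bounded on `L^p(w)`: it maps every Lebesgue measurable `f` with `‖f‖_{L^p(w)} < ∞`
to an element of `L^p(w)`, with norm at most `C ‖f‖_{L^p(w)}`, where `C` does not depend on `f`. -/
def BoundedOnLp {n : ℕ} (τ p : ℝ) (w : (Fin n → ℝ) → ℝ≥0) : Prop :=
  ∃ C : ℝ≥0, ∀ f : (Fin n → ℝ) → ℝ, AEMeasurable f volume →
    eLpNorm f (ENNReal.ofReal p) (weightMeasure w) < ∞ →
      MemLp (levelMaximal τ f) (ENNReal.ofReal p) (weightMeasure w) ∧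
      eLpNorm (levelMaximal τ f) (ENNReal.ofReal p) (weightMeasure w)
        ≤ C * eLpNorm f (ENNReal.ofReal p) (weightMeasure w)

/-- `[w]_{A_1} = sup_Q (w(Q) / |Q|) ‖w⁻¹‖_{L^∞(Q)}`, computed in `[0, ∞]`
with `0⁻¹ = ∞` and `0 * ∞ = 0`. -/
def A1Const {n : ℕ} (w : (Fin n → ℝ) → ℝ≥0) : ℝ≥0∞ :=
  ⨆ (Q : Set (Fin n → ℝ)) (_ : IsCube Q),
    (weightMeasure w Q / volume Q) *
      essSup (fun x => (w x : ℝ≥0∞)⁻¹) (volume.restrict Q)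

/-- `[w]_{A_q} = sup_Q (w(Q) / |Q|) (σ(Q) / |Q|)^(q-1)` with `σ = w^(-1/(q-1))`, for `1 < q < ∞`,
computed in `[0, ∞]` with `0^(-1/(q-1)) = ∞` and `0 * ∞ = 0`. -/
def ApConst {n : ℕ} (q : ℝ) (w : (Fin n → ℝ) → ℝ≥0) : ℝ≥0∞ :=
  ⨆ (Q : Set (Fin n → ℝ)) (_ : IsCube Q),
    (weightMeasure w Q / volume Q) *
      ((∫⁻ x in Q, (w x : ℝ≥0∞) ^ (-1 / (q - 1))) / volume Q) ^ (q - 1)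

/-- The Muckenhoupt class `A_q`, `1 ≤ q < ∞`. -/
def IsAp {n : ℕ} (q : ℝ) (w : (Fin n → ℝ) → ℝ≥0) : Prop :=
  (q = 1 ∧ A1Const w < ∞) ∨ (1 < q ∧ ApConst q w < ∞)

/-- `A_∞` is the union of the classes `A_q`, `1 ≤ q < ∞`. -/
def IsAInfty {n : ℕ} (w : (Fin n → ℝ) → ℝ≥0) : Prop :=
  ∃ q : ℝ, IsAp q w

end MedianMaximal

end

/-!
Both sides are equivalent to a bound `μ B ≤ K * μ (A ∩ B)`, where `μ = w dx`, for all cubes `B` in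
which `A` has relative Lebesgue measure at least `τ`.

Testing `𝓜^τ` on the indicator of `A ∩ B`, whose maximal function is at least `1` on `B`, gives
this bound for the given `τ`. If `w ∈ A_q`, Hölder's inequality gives it for every `τ > 0`, hence
also the doubling property of `μ`; as `{𝓜^τ f > a}` is covered by cubes in which `{|f| > a}` has
density at least `τ`, Vitali's covering lemma yields `μ {𝓜^τ f > a} ≤ C * μ {|f| > a}`, and this
integrates to an `L^p` bound for every `p`.

Conversely, the bound for a single `τ < 1` improves itself. If `A ⊆ B` has density less than `τ`
in `B`, apply homotheties centred at a density point of `A` to `B`, with ratios `ρ ^ k`, and stop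
at the first image in which `A` has density at least `τ`. The union `V` of a Vitali subfamily of
these images has measure comparable to that of `A`, and `A` has density at most `τ / ρ ^ n < 1` in
it, so `A ∪ V` is larger than `A` by a factor `s > 1`, while its `μ`-measure is at most
`(1 + K) * μ A`. Iterating, the parts of `B` where `w` is at most `(2 + K)⁻¹ ^ k` times its mean
decay geometrically in measure, so a small negative power of `w` satisfies the `A_q` bound.
-/

namespace MedianMaximal

open Filter Metric Module Set Topology

section Distribution

variable {α : Type*} [MeasurableSpace α] {μ : Measure α}

lemma lintegral_eq_lintegral_meas_ofReal_lt {f : α → ℝ≥0∞} (hf : AEMeasurable f μ) :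
    ∫⁻ x, f x ∂μ = ∫⁻ t in Ioi (0 : ℝ), μ {x | ENNReal.ofReal t < f x} := by
  by_cases htop : μ {x | f x = ∞} = 0
  · have hfin : ∀ᵐ x ∂μ, f x ≠ ∞ := measure_eq_zero_iff_ae_notMem.1 htop
    calc ∫⁻ x, f x ∂μ = ∫⁻ x, ENNReal.ofReal (f x).toReal ∂μ :=
          lintegral_congr_ae (hfin.mono fun x hx => (ENNReal.ofReal_toReal hx).symm)
      _ = ∫⁻ t in Ioi (0 : ℝ), μ {x | t < (f x).toReal} :=
          lintegral_eq_lintegral_meas_lt μ (ae_of_all _ fun _ => ENNReal.toReal_nonneg)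
            hf.ennreal_toReal
      _ = _ := setLIntegral_congr_fun measurableSet_Ioi fun t ht => measure_congr <| by
          filter_upwards [hfin] with x hx
          exact propext (ENNReal.ofReal_lt_iff_lt_toReal (mem_Ioi.1 ht).le hx).symm
  · refine (lintegral_eq_top_of_measure_eq_top_ne_zero hf htop).trans (top_unique ?_).symm
    calc ∞ = ∫⁻ _ in Ioi (0 : ℝ), μ {x | f x = ∞} := by
          rw [setLIntegral_const, Real.volume_Ioi, ENNReal.mul_top htop]
      _ ≤ _ := lintegral_mono fun t => measure_mono fun x (hx : f x = ∞) => by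
          simp only [mem_ofPred_eq, hx, ENNReal.ofReal_lt_top]

lemma lintegral_le_mul_of_meas_lt_le {f g : α → ℝ≥0∞} (hf : AEMeasurable f μ)
    (hg : AEMeasurable g μ) {K : ℝ≥0} (h : ∀ a, μ {x | a < g x} ≤ K * μ {x | a < f x}) :
    ∫⁻ x, g x ∂μ ≤ K * ∫⁻ x, f x ∂μ := by
  rw [lintegral_eq_lintegral_meas_ofReal_lt hf, lintegral_eq_lintegral_meas_ofReal_lt hg,
    ← lintegral_const_mul' _ _ ENNReal.coe_ne_top]
  exact lintegral_mono fun t => h _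

lemma eLpNorm_le_mul_of_meas_lt_enorm_le {ε ε' : Type*} [ENorm ε] [ENorm ε'] {f : α → ε}
    {g : α → ε'} (hf : AEMeasurable (fun x => ‖f x‖ₑ) μ) (hg : AEMeasurable (fun x => ‖g x‖ₑ) μ)
    {p : ℝ≥0∞} (hp0 : p ≠ 0) (hp : p ≠ ∞) {K : ℝ≥0}
    (h : ∀ a, μ {x | a < ‖g x‖ₑ} ≤ K * μ {x | a < ‖f x‖ₑ}) :
    eLpNorm g p μ ≤ (K ^ (1 / p.toReal) : ℝ≥0) * eLpNorm f p μ := by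
  have hp' : 0 < p.toReal := ENNReal.toReal_pos hp0 hp
  rw [eLpNorm_eq_lintegral_rpow_enorm_toReal hp0 hp, eLpNorm_eq_lintegral_rpow_enorm_toReal hp0 hp,
    ENNReal.coe_rpow_of_nonneg _ (by positivity), ← ENNReal.mul_rpow_of_nonneg _ _ (by positivity)]
  gcongr
  refine lintegral_le_mul_of_meas_lt_le (hf.pow_const _) (hg.pow_const _) fun a => ?_
  simpa only [ENNReal.rpow_inv_lt_iff hp'] using h (a ^ p.toReal⁻¹)

lemma rpow_le_one_add_tsum {β : ℝ≥0} (hβ : 1 < β) {δ : ℝ} (hδ : 0 < δ) (u : ℝ≥0∞) :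
    u ^ δ ≤ 1 + ∑' k : ℕ, (Ici ((β : ℝ≥0∞) ^ k)).indicator
      (fun _ => ((β : ℝ≥0∞) ^ δ) ^ (k + 1)) u := by
  have hβδ : 1 ≤ (β : ℝ≥0∞) ^ δ := ENNReal.one_le_rpow (by exact_mod_cast hβ.le) hδ
  rcases eq_or_ne u ∞ with rfl | hu
  · have hdiv : ∑' _ : ℕ, (1 : ℝ≥0∞) = ∞ := ENNReal.tsum_const_eq_top_of_ne_zero one_ne_zero
    refine le_top.trans (hdiv.ge.trans (le_add_left (ENNReal.tsum_le_tsum fun k => ?_)))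
    rw [indicator_of_mem (mem_Ici.2 le_top)]
    exact one_le_pow₀ hβδ
  lift u to ℝ≥0 using hu
  rcases lt_or_ge u 1 with hu1 | hu1
  · exact le_add_right (ENNReal.rpow_le_one (by exact_mod_cast hu1.le) hδ.le)
  · obtain ⟨k, hk, hk'⟩ := exists_nat_pow_near hu1 hβ
    refine le_add_left (le_trans ?_ (ENNReal.le_tsum k))
    rw [indicator_of_mem (mem_Ici.2 (by exact_mod_cast hk)), ← ENNReal.rpow_natCast,
      ← ENNReal.rpow_mul, mul_comm, ENNReal.rpow_mul, ENNReal.rpow_natCast]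
    gcongr
    exact_mod_cast hk'.le

lemma lintegral_rpow_le_of_geometric_decay {u : α → ℝ≥0∞} (hu : AEMeasurable u μ) {β : ℝ≥0}
    (hβ : 1 < β) {δ : ℝ} (hδ : 0 < δ) {C t : ℝ≥0∞}
    (hdecay : ∀ k : ℕ, μ {x | (β : ℝ≥0∞) ^ k ≤ u x} ≤ C * t ^ k) :
    ∫⁻ x, u x ^ δ ∂μ ≤ μ univ + (β : ℝ≥0∞) ^ δ * C * (1 - (β : ℝ≥0∞) ^ δ * t)⁻¹ := by
  have hlevel : ∀ k : ℕ, NullMeasurableSet {x | (β : ℝ≥0∞) ^ k ≤ u x} μ := fun k =>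
    nullMeasurableSet_le aemeasurable_const hu
  calc ∫⁻ x, u x ^ δ ∂μ
      ≤ ∫⁻ x, 1 + ∑' k : ℕ, {x | (β : ℝ≥0∞) ^ k ≤ u x}.indicator
          (fun _ => ((β : ℝ≥0∞) ^ δ) ^ (k + 1)) x ∂μ :=
        lintegral_mono fun x => rpow_le_one_add_tsum hβ hδ (u x)
    _ = μ univ + ∑' k : ℕ, ((β : ℝ≥0∞) ^ δ) ^ (k + 1) * μ {x | (β : ℝ≥0∞) ^ k ≤ u x} := by
        rw [lintegral_add_left measurable_const, lintegral_one,
          lintegral_tsum fun k => aemeasurable_const.indicator₀ (hlevel k)]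
        simp only [lintegral_indicator_const₀ (hlevel _)]
    _ ≤ μ univ + ∑' k : ℕ, ((β : ℝ≥0∞) ^ δ) ^ (k + 1) * (C * t ^ k) := by
        gcongr with k
        exact hdecay k
    _ = μ univ + ∑' k : ℕ, (β : ℝ≥0∞) ^ δ * C * ((β : ℝ≥0∞) ^ δ * t) ^ k := by
        congr 1
        exact tsum_congr fun k => by ring
    _ = _ := by rw [ENNReal.tsum_mul_left, ENNReal.tsum_geometric]

lemma measure_univ_rpow_le_lintegral_mul_lintegral_rpow {w : α → ℝ≥0} (hw : AEMeasurable w μ)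
    {q : ℝ} (hq : 1 < q) (hσ : ∫⁻ x, (w x : ℝ≥0∞) ^ (-1 / (q - 1)) ∂μ ≠ ∞) :
    μ univ ^ q ≤
      (∫⁻ x, (w x : ℝ≥0∞) ∂μ) * (∫⁻ x, (w x : ℝ≥0∞) ^ (-1 / (q - 1)) ∂μ) ^ (q - 1) := by
  have hq0 : 0 < q := by linarith
  have hq1 : 0 < q - 1 := by linarith
  have hwm : AEMeasurable (fun x => (w x : ℝ≥0∞)) μ := hw.coe_nnreal_ennreal
  have hpos : ∀ᵐ x ∂μ, (w x : ℝ≥0∞) ≠ 0 := by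
    filter_upwards [ae_lt_top' (hwm.pow_const _) hσ] with x hx h0
    rw [h0, ENNReal.zero_rpow_of_neg (div_neg_of_neg_of_pos (by norm_num) hq1)] at hx
    exact lt_irrefl _ hx
  have hsplit : μ univ = ∫⁻ x, (w x : ℝ≥0∞) ^ (1 / q) * (w x : ℝ≥0∞) ^ (-1 / q) ∂μ := by
    rw [← lintegral_one]
    refine lintegral_congr_ae ?_
    filter_upwards [hpos] with x hx
    rw [← ENNReal.rpow_add _ _ hx ENNReal.coe_ne_top, neg_div, add_neg_cancel, ENNReal.rpow_zero]
  have hleft : ∀ x, ((w x : ℝ≥0∞) ^ (1 / q)) ^ q = w x := fun x => by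
    rw [← ENNReal.rpow_mul, one_div_mul_cancel hq0.ne', ENNReal.rpow_one]
  have hright : ∀ x, ((w x : ℝ≥0∞) ^ (-1 / q)) ^ (q / (q - 1)) = (w x : ℝ≥0∞) ^ (-1 / (q - 1)) :=
    fun x => by
      rw [← ENNReal.rpow_mul]
      congr 1
      field_simp
  have hHolder := ENNReal.lintegral_mul_le_Lp_mul_Lq μ (Real.HolderConjugate.conjExponent hq)
    (hwm.pow_const (1 / q)) (hwm.pow_const (-1 / q))
  simp only [Pi.mul_apply, ← hsplit, Real.conjExponent, hleft, hright] at hHolder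
  calc μ univ ^ q ≤ _ := ENNReal.rpow_le_rpow hHolder hq0.le
    _ = _ := by
      rw [ENNReal.mul_rpow_of_nonneg _ _ hq0.le, ← ENNReal.rpow_mul, ← ENNReal.rpow_mul,
        one_div_mul_cancel hq0.ne', ENNReal.rpow_one]
      congr 2
      field_simp

lemma one_add_mul_measure_le_measure_union {A V : Set α} (hA : NullMeasurableSet A μ)
    {θ C : ℝ≥0∞} (hinter : μ (A ∩ V) ≤ θ * μ V) (hcover : μ A ≤ C * μ V) (hV : μ V ≠ ∞) :
    (1 + (1 - θ) / C) * μ A ≤ μ (A ∪ V) :=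
  calc (1 + (1 - θ) / C) * μ A = μ A + (1 - θ) * (μ A / C) := by
        rw [add_mul, one_mul, div_eq_mul_inv, div_eq_mul_inv, mul_assoc, mul_comm C⁻¹]
    _ ≤ μ A + (1 - θ) * μ V := by
        gcongr
        exact ENNReal.div_le_of_le_mul' hcover
    _ = μ A + (μ V - θ * μ V) := by rw [ENNReal.sub_mul fun _ _ => hV, one_mul]
    _ ≤ μ A + (μ V - μ (A ∩ V)) := by gcongr
    _ ≤ μ A + μ (V \ A) := by
        gcongr
        rw [tsub_le_iff_right, inter_comm, add_comm]
        exact measure_le_inter_add_sdiff μ V A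
    _ = μ (A ∪ V) := by
        rw [← measure_union₀' hA disjoint_sdiff_right.aedisjoint, union_sdiff_self]

end Distribution

section Covering

variable {X : Type*} [PseudoMetricSpace X] [MeasurableSpace X] {ν μ : Measure X} {τ : ℝ≥0∞}
  {K : ℝ≥0}

/-- Quantitative absolute continuity of `μ` with respect to `ν` on balls: a subset carrying the
fraction `τ` of the `ν`-measure of a ball carries at least `1 / K` of its `μ`-measure. The set `A`
need not lie in the ball. -/
def LargeSubsetBound (ν μ : Measure X) (τ : ℝ≥0∞) (K : ℝ≥0) : Prop :=
  ∀ (c : X) (r : ℝ), 0 < r → ∀ A : Set X, NullMeasurableSet A ν →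
    τ * ν (closedBall c r) ≤ ν (A ∩ closedBall c r) →
      μ (closedBall c r) ≤ K * μ (A ∩ closedBall c r)

/-- The union of the closed balls of positive radius in which `A` has `ν`-density at least `τ`. -/
def denseBallUnion (ν : Measure X) (τ : ℝ≥0∞) (A : Set X) : Set X :=
  {x | ∃ (c : X) (r : ℝ), 0 < r ∧ x ∈ closedBall c r ∧
    τ * ν (closedBall c r) ≤ ν (A ∩ closedBall c r)}

lemma LargeSubsetBound.measure_closedBall_ne_top [SigmaFinite μ] (h : LargeSubsetBound ν μ τ K)
    (hτ : τ < 1) {c : X} {r : ℝ} (hr : 0 < r) (h0 : ν (closedBall c r) ≠ 0)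
    (htop : ν (closedBall c r) ≠ ∞) : μ (closedBall c r) ≠ ∞ := by
  have hlt : τ * ν (closedBall c r) < ⨆ N, ν (spanningSets μ N ∩ closedBall c r) := by
    rw [← Monotone.measure_iUnion fun N M hNM =>
      inter_subset_inter_left _ (monotone_spanningSets μ hNM), ← iUnion_inter,
      iUnion_spanningSets, univ_inter]
    calc τ * ν (closedBall c r) < 1 * ν (closedBall c r) := ENNReal.mul_lt_mul_left h0 htop hτ
      _ = ν (closedBall c r) := one_mul _
  obtain ⟨N, hN⟩ := lt_iSup_iff.1 hlt
  refine ne_top_of_le_ne_top (ENNReal.mul_ne_top ENNReal.coe_ne_top ?_) <|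
    h c r hr _ (measurableSet_spanningSets μ N).nullMeasurableSet hN.le
  exact measure_ne_top_of_subset inter_subset_left (measure_spanningSets_lt_top μ N).ne

variable [OpensMeasurableSpace X]

lemma LargeSubsetBound.measure_biUnion_le (h : LargeSubsetBound ν μ τ K) {A : Set X}
    (hA : NullMeasurableSet A ν) {u : Set (X × ℝ)} (hu : u.Countable)
    (hdisj : u.PairwiseDisjoint fun a => closedBall a.1 a.2)
    (hdense : ∀ a ∈ u, 0 < a.2 ∧ τ * ν (closedBall a.1 a.2) ≤ ν (A ∩ closedBall a.1 a.2)) :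
    μ (⋃ a ∈ u, closedBall a.1 a.2) ≤ K * μ (A ∩ ⋃ a ∈ u, closedBall a.1 a.2) := by
  obtain ⟨A', hA'A, hA', hae⟩ := hA.exists_measurable_subset_ae_eq
  have hball : ∀ a ∈ u, μ (closedBall a.1 a.2) ≤ K * μ (A' ∩ closedBall a.1 a.2) := fun a ha =>
    h a.1 a.2 (hdense a ha).1 A' hA'.nullMeasurableSet <|
      (hdense a ha).2.trans_eq (measure_congr (hae.symm.inter (ae_eq_refl _)))
  calc μ (⋃ a ∈ u, closedBall a.1 a.2)
      = ∑' a : u, μ (closedBall a.1.1 a.1.2) :=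
        measure_biUnion hu hdisj fun _ _ => measurableSet_closedBall
    _ ≤ ∑' a : u, K * μ (A' ∩ closedBall a.1.1 a.1.2) :=
        ENNReal.tsum_le_tsum fun a => hball a a.2
    _ = K * μ (A' ∩ ⋃ a ∈ u, closedBall a.1 a.2) := by
        rw [ENNReal.tsum_mul_left, inter_iUnion₂, measure_biUnion hu
          (hdisj.mono fun _ => inter_subset_right) fun _ _ => hA'.inter measurableSet_closedBall]
    _ ≤ K * μ (A ∩ ⋃ a ∈ u, closedBall a.1 a.2) := by gcongr

variable [TopologicalSpace.SeparableSpace X]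

lemma exists_disjoint_subfamily_measure_biUnion_le {D : ℝ≥0∞}
    (hD : ∀ (c : X) (r : ℝ), 0 < r → μ (closedBall c (5 * r)) ≤ D * μ (closedBall c r))
    {t : Set (X × ℝ)} {R : ℝ} (ht : ∀ a ∈ t, 0 < a.2 ∧ a.2 ≤ R) :
    ∃ u ⊆ t, u.Countable ∧ (u.PairwiseDisjoint fun a => closedBall a.1 a.2) ∧
      μ (⋃ a ∈ t, closedBall a.1 a.2) ≤ D * μ (⋃ a ∈ u, closedBall a.1 a.2) := by
  obtain ⟨u, hut, hdisj, hcover⟩ := Vitali.exists_disjoint_subfamily_covering_enlargement_closedBall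
    t Prod.fst Prod.snd R (fun a ha => (ht a ha).2) 5 (by norm_num)
  have hu : u.Countable := hdisj.countable_of_nonempty_interior fun a ha =>
    ⟨a.1, ball_subset_interior_closedBall (mem_ball_self (ht a (hut ha)).1)⟩
  refine ⟨u, hut, hu, hdisj, ?_⟩
  calc μ (⋃ a ∈ t, closedBall a.1 a.2)
      ≤ μ (⋃ a ∈ u, closedBall a.1 (5 * a.2)) := by
        refine measure_mono (iUnion₂_subset fun a ha => ?_)
        obtain ⟨b, hb, hab⟩ := hcover a ha
        exact hab.trans (subset_biUnion_of_mem (u := fun a : X × ℝ => closedBall a.1 (5 * a.2)) hb)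
    _ ≤ ∑' a : u, μ (closedBall a.1.1 (5 * a.1.2)) := MeasureTheory.measure_biUnion_le _ hu _
    _ ≤ ∑' a : u, D * μ (closedBall a.1.1 a.1.2) :=
        ENNReal.tsum_le_tsum fun a => hD _ _ (ht a (hut a.2)).1
    _ = D * μ (⋃ a ∈ u, closedBall a.1 a.2) := by
        rw [ENNReal.tsum_mul_left, measure_biUnion hu hdisj fun _ _ => measurableSet_closedBall]

lemma LargeSubsetBound.measure_denseBallUnion_le (h : LargeSubsetBound ν μ τ K) {D : ℝ≥0∞}
    (hD : ∀ (c : X) (r : ℝ), 0 < r → μ (closedBall c (5 * r)) ≤ D * μ (closedBall c r))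
    {A : Set X} (hA : NullMeasurableSet A ν) :
    μ (denseBallUnion ν τ A) ≤ D * K * μ A := by
  let t : ℕ → Set (X × ℝ) := fun N => {a | (0 < a.2 ∧ a.2 ≤ N) ∧
    τ * ν (closedBall a.1 a.2) ≤ ν (A ∩ closedBall a.1 a.2)}
  have ht : Monotone t := fun N M hNM a ha =>
    ⟨⟨ha.1.1, ha.1.2.trans (by exact_mod_cast hNM)⟩, ha.2⟩
  have hexhaust : denseBallUnion ν τ A ⊆ ⋃ N, ⋃ a ∈ t N, closedBall a.1 a.2 := by
    rintro x ⟨c, r, hr, hx, hdense⟩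
    obtain ⟨N, hN⟩ := exists_nat_ge r
    exact mem_iUnion.2 ⟨N, mem_biUnion (x := (c, r)) ⟨⟨hr, hN⟩, hdense⟩ hx⟩
  refine (measure_mono hexhaust).trans ?_
  rw [Monotone.measure_iUnion fun N M hNM => biUnion_subset_biUnion_left (ht hNM)]
  refine iSup_le fun N => ?_
  obtain ⟨u, hut, hu, hdisj, hle⟩ :=
    exists_disjoint_subfamily_measure_biUnion_le hD (t := t N) fun a ha => ha.1
  calc μ (⋃ a ∈ t N, closedBall a.1 a.2) ≤ D * μ (⋃ a ∈ u, closedBall a.1 a.2) := hle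
    _ ≤ D * (K * μ (A ∩ ⋃ a ∈ u, closedBall a.1 a.2)) := by
        gcongr
        exact h.measure_biUnion_le hA hu hdisj fun a ha => ⟨(hut ha).1.1, (hut ha).2⟩
    _ ≤ D * (K * μ A) := by
        gcongr
        exact inter_subset_left
    _ = D * K * μ A := (mul_assoc _ _ _).symm

end Covering

section Homothety

variable {E : Type*} [NormedAddCommGroup E] [NormedSpace ℝ E]

/-- The image of `closedBall c r` under the homothety with centre `x` and ratio `t`. For a point `x`
of the ball these images shrink to `x` as `t → 0` while always containing `x`. -/
def homotheticBall (x c : E) (r t : ℝ) : Set E :=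
  closedBall (AffineMap.lineMap x c t) (t * r)

lemma homotheticBall_one (x c : E) (r : ℝ) : homotheticBall x c r 1 = closedBall c r := by
  rw [homotheticBall, AffineMap.lineMap_apply_one, one_mul]

lemma mem_homotheticBall {x c : E} {r t : ℝ} (hx : x ∈ closedBall c r) (ht : 0 ≤ t) :
    x ∈ homotheticBall x c r t := by
  rw [homotheticBall, mem_closedBall, dist_left_lineMap, Real.norm_of_nonneg ht]
  exact mul_le_mul_of_nonneg_left hx ht

lemma homotheticBall_mono {x c : E} {r : ℝ} (hx : x ∈ closedBall c r) :
    Monotone (homotheticBall x c r) := fun s t hst => by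
  refine closedBall_subset_closedBall' ?_
  rw [dist_lineMap_lineMap, Real.dist_eq, abs_sub_comm, abs_of_nonneg (sub_nonneg.2 hst)]
  linarith [mul_le_mul_of_nonneg_left (mem_closedBall.1 hx) (sub_nonneg.2 hst)]

lemma homotheticBall_subset_closedBall {x c : E} {r t : ℝ} (hx : x ∈ closedBall c r)
    (ht : t ≤ 1) : homotheticBall x c r t ⊆ closedBall c r :=
  (homotheticBall_mono hx ht).trans_eq (homotheticBall_one x c r)

variable [FiniteDimensional ℝ E] [MeasurableSpace E] [BorelSpace E] (ν : Measure E)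
  [ν.IsAddHaarMeasure]

lemma addHaar_closedBall_mul_eq (x y : E) {t : ℝ} (ht : 0 < t) (r : ℝ) :
    ν (closedBall x (t * r)) = ENNReal.ofReal (t ^ finrank ℝ E) * ν (closedBall y r) := by
  rw [Measure.addHaar_closedBall_mul_of_pos ν x ht, Measure.addHaar_closedBall_center ν y]

lemma LargeSubsetBound.measure_closedBall_five_mul_le {ν μ : Measure E} [ν.IsAddHaarMeasure]
    {D : ℝ≥0} (h : LargeSubsetBound ν μ ((5 ^ finrank ℝ E)⁻¹ : ℝ≥0) D) (c : E) {r : ℝ}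
    (hr : 0 < r) : μ (closedBall c (5 * r)) ≤ D * μ (closedBall c r) := by
  have hsub : closedBall c r ⊆ closedBall c (5 * r) := closedBall_subset_closedBall (by linarith)
  have hfive : ENNReal.ofReal (5 ^ finrank ℝ E) = ((5 ^ finrank ℝ E : ℝ≥0) : ℝ≥0∞) := by
    rw [ENNReal.ofReal_pow (by norm_num), ENNReal.ofReal_ofNat, ENNReal.coe_pow, ENNReal.coe_ofNat]
  have hbound := h c (5 * r) (by positivity) (closedBall c r)
    measurableSet_closedBall.nullMeasurableSet
  rw [inter_eq_left.2 hsub] at hbound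
  refine hbound (le_of_eq ?_)
  rw [addHaar_closedBall_mul_eq ν c c (by norm_num), hfive, ← mul_assoc, ← ENNReal.coe_mul,
    inv_mul_cancel₀ (by positivity), ENNReal.coe_one, one_mul]

lemma ae_tendsto_density_homotheticBall (A : Set E) :
    ∀ᵐ x ∂ν.restrict A, ∀ (c : E) (r : ℝ), 0 < r → x ∈ closedBall c r →
      Tendsto (fun t => ν (A ∩ homotheticBall x c r t) / ν (homotheticBall x c r t))
        (𝓝[>] 0) (𝓝 1) := by
  filter_upwards [IsUnifLocDoublingMeasure.ae_tendsto_measure_inter_div ν A 1] with x hx c r hr hxc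
  refine hx _ _ (tendsto_nhdsWithin_iff.2 ⟨?_, ?_⟩) ?_
  · have hcont : Continuous fun t : ℝ => t * r := by fun_prop
    simpa only [zero_mul] using hcont.tendsto 0 |>.mono_left nhdsWithin_le_nhds
  · filter_upwards [self_mem_nhdsWithin] with t ht using mul_pos ht hr
  · filter_upwards [self_mem_nhdsWithin] with t ht
    rw [one_mul]
    exact mem_homotheticBall hxc (mem_Ioi.1 ht).le

lemma ae_eventually_density_homotheticBall {A : Set E} (hA : NullMeasurableSet A ν) {τ : ℝ≥0∞}
    (hτ : τ < 1) :
    ∀ᵐ x ∂ν, x ∈ A → ∀ (c : E) (r : ℝ), 0 < r → x ∈ closedBall c r →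
      ∀ᶠ t in 𝓝[>] 0, τ * ν (homotheticBall x c r t) ≤ ν (A ∩ homotheticBall x c r t) := by
  filter_upwards [(ae_restrict_iff'₀ hA).1 (ae_tendsto_density_homotheticBall ν A)]
    with x hx hxA c r hr hxc
  filter_upwards [(hx hxA c r hr hxc).eventually_const_lt hτ] with t ht
  exact ENNReal.mul_le_of_le_div ht.le

lemma nullMeasurableSet_biUnion_closedBall {s : Set (E × ℝ)} (hs : ∀ a ∈ s, 0 < a.2) :
    NullMeasurableSet (⋃ a ∈ s, closedBall a.1 a.2) ν := by
  let O : Set E := ⋃ a ∈ s, ball a.1 a.2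
  have hO : MeasurableSet O := (isOpen_biUnion fun _ _ => isOpen_ball).measurableSet
  have hsub : O ⊆ ⋃ a ∈ s, closedBall a.1 a.2 := iUnion₂_mono fun _ _ => ball_subset_closedBall
  refine hO.nullMeasurableSet.congr (hsub.eventuallyLE.antisymm ?_)
  filter_upwards [ae_eventually_density_homotheticBall ν hO.compl.nullMeasurableSet
    (τ := 2⁻¹) ENNReal.one_half_lt_one] with x hx hxs
  by_contra hxO
  obtain ⟨⟨c, r⟩, ha, hxc⟩ := mem_iUnion₂.1 hxs
  have hr : 0 < r := hs _ ha
  obtain ⟨t, hdense, ht0 : 0 < t, ht1⟩ := ((hx hxO c r hr hxc).and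
    (Ioc_mem_nhdsGT zero_lt_one)).exists
  have hsphere : Oᶜ ∩ homotheticBall x c r t ⊆ sphere c r := fun y hy =>
    (mem_closedBall.1 (homotheticBall_subset_closedBall hxc ht1 hy.2)).antisymm <|
      not_lt.1 fun hyc => hy.1 (mem_biUnion ha (mem_ball.2 hyc))
  rw [measure_mono_null hsphere (Measure.addHaar_sphere_of_ne_zero ν c hr.ne'),
    nonpos_iff_eq_zero] at hdense
  refine mul_ne_zero (ENNReal.inv_ne_zero.2 ENNReal.ofNat_ne_top) ?_ hdense
  exact (measure_closedBall_pos ν _ (mul_pos ht0 hr)).ne'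

end Homothety

section StoppingBalls

variable {E : Type*} [NormedAddCommGroup E] [NormedSpace ℝ E] [FiniteDimensional ℝ E]
  [MeasurableSpace E] [BorelSpace E] {ν : Measure E} [ν.IsAddHaarMeasure] {τ : ℝ≥0∞}

lemma exists_homotheticBall_density_le {ρ : ℝ} (hρ0 : 0 < ρ) (hρ1 : ρ < 1) {A : Set E} {x c : E}
    {r : ℝ} (hx : x ∈ closedBall c r) (hsparse : ν (A ∩ closedBall c r) < τ * ν (closedBall c r))
    (hdense : ∀ᶠ t in 𝓝[>] 0,
      τ * ν (homotheticBall x c r t) ≤ ν (A ∩ homotheticBall x c r t)) :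
    ∃ t ∈ Ioc (0 : ℝ) 1, τ * ν (homotheticBall x c r t) ≤ ν (A ∩ homotheticBall x c r t) ∧
      ν (A ∩ homotheticBall x c r t) ≤
        τ / ENNReal.ofReal (ρ ^ finrank ℝ E) * ν (homotheticBall x c r t) := by
  classical
  have hexists : ∃ k : ℕ,
      τ * ν (homotheticBall x c r (ρ ^ k)) ≤ ν (A ∩ homotheticBall x c r (ρ ^ k)) :=
    ((tendsto_pow_atTop_nhdsWithin_zero_of_lt_one hρ0 hρ1).eventually hdense).exists
  obtain ⟨k, hk⟩ : ∃ k, Nat.find hexists = k + 1 := Nat.exists_eq_succ_of_ne_zero fun h0 => by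
    have hspec := Nat.find_spec hexists
    rw [h0, pow_zero, homotheticBall_one] at hspec
    exact hsparse.not_ge hspec
  have hprev := Nat.find_min hexists (m := k) (by lia)
  refine ⟨ρ ^ (k + 1), ⟨by positivity, pow_le_one₀ hρ0.le hρ1.le⟩, hk ▸ Nat.find_spec hexists, ?_⟩
  have hcancel : ENNReal.ofReal (ρ ^ finrank ℝ E) ≠ 0 :=
    (ENNReal.ofReal_pos.2 (by positivity)).ne'
  calc ν (A ∩ homotheticBall x c r (ρ ^ (k + 1)))
      ≤ ν (A ∩ homotheticBall x c r (ρ ^ k)) := by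
        gcongr
        exact homotheticBall_mono hx (pow_le_pow_of_le_one hρ0.le hρ1.le k.le_succ)
    _ ≤ τ * ν (homotheticBall x c r (ρ ^ k)) := (not_le.1 hprev).le
    _ = τ / ENNReal.ofReal (ρ ^ finrank ℝ E) * ν (homotheticBall x c r (ρ ^ (k + 1))) := by
        rw [homotheticBall, homotheticBall, pow_succ', mul_assoc, addHaar_closedBall_mul_eq ν _
          (AffineMap.lineMap x c (ρ ^ k)) hρ0, ← mul_assoc,
          ENNReal.div_mul_cancel hcancel ENNReal.ofReal_ne_top]

lemma exists_disjoint_closedBalls_density_le (hτ : τ < 1) {ρ : ℝ} (hρ0 : 0 < ρ) (hρ1 : ρ < 1)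
    {A : Set E} (hA : NullMeasurableSet A ν) {c : E} {r : ℝ} (hr : 0 < r)
    (hAB : A ⊆ closedBall c r) (hsparse : ν A < τ * ν (closedBall c r)) :
    ∃ u : Set (E × ℝ), u.Countable ∧ (u.PairwiseDisjoint fun a => closedBall a.1 a.2) ∧
      (∀ a ∈ u, closedBall a.1 a.2 ⊆ closedBall c r) ∧
      (∀ a ∈ u, 0 < a.2 ∧ τ * ν (closedBall a.1 a.2) ≤ ν (A ∩ closedBall a.1 a.2)) ∧
      (∀ a ∈ u, ν (A ∩ closedBall a.1 a.2) ≤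
        τ / ENNReal.ofReal (ρ ^ finrank ℝ E) * ν (closedBall a.1 a.2)) ∧
      ν A ≤ ENNReal.ofReal (5 ^ finrank ℝ E) * ν (⋃ a ∈ u, closedBall a.1 a.2) := by
  let s : Set (E × ℝ) := {a | (0 < a.2 ∧ a.2 ≤ r) ∧ closedBall a.1 a.2 ⊆ closedBall c r ∧
    τ * ν (closedBall a.1 a.2) ≤ ν (A ∩ closedBall a.1 a.2) ∧
    ν (A ∩ closedBall a.1 a.2) ≤
      τ / ENNReal.ofReal (ρ ^ finrank ℝ E) * ν (closedBall a.1 a.2)}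
  have hcover : A ≤ᵐ[ν] (⋃ a ∈ s, closedBall a.1 a.2 : Set E) := by
    filter_upwards [ae_eventually_density_homotheticBall ν hA hτ] with x hx hxA
    have hxB := hAB hxA
    obtain ⟨t, ht, hge, hle⟩ := exists_homotheticBall_density_le hρ0 hρ1 hxB
      (by rwa [inter_eq_left.2 hAB]) (hx hxA c r hr hxB)
    exact mem_biUnion (x := (AffineMap.lineMap x c t, t * r))
      ⟨⟨mul_pos ht.1 hr, mul_le_of_le_one_left hr.le ht.2⟩,
        homotheticBall_subset_closedBall hxB ht.2, hge, hle⟩ (mem_homotheticBall hxB ht.1.le)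
  obtain ⟨u, hus, hu, hdisj, hle⟩ := exists_disjoint_subfamily_measure_biUnion_le
    (fun y R _ => (addHaar_closedBall_mul_eq ν y y (by norm_num) R).le) (t := s) fun a ha => ha.1
  exact ⟨u, hu, hdisj, fun a ha => (hus ha).2.1, fun a ha => ⟨(hus ha).1.1, (hus ha).2.2.1⟩,
    fun a ha => (hus ha).2.2.2, (measure_mono_ae hcover).trans hle⟩

end StoppingBalls

section SelfImprovement

variable {E : Type*} [NormedAddCommGroup E] [NormedSpace ℝ E] [FiniteDimensional ℝ E]
  [MeasurableSpace E] [BorelSpace E] {ν μ : Measure E} [ν.IsAddHaarMeasure] {τ : ℝ≥0∞} {K : ℝ≥0}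

lemma exists_lt_ofReal_pow_of_lt_one (d : ℕ) {τ : ℝ≥0∞} (hτ : τ < 1) :
    ∃ ρ : ℝ, 0 < ρ ∧ ρ < 1 ∧ τ < ENNReal.ofReal (ρ ^ d) := by
  have hcont : Continuous fun ρ : ℝ => ENNReal.ofReal (ρ ^ d) :=
    ENNReal.continuous_ofReal.comp (continuous_pow d)
  have hlim : Tendsto (fun ρ : ℝ => ENNReal.ofReal (ρ ^ d)) (𝓝[<] 1) (𝓝 1) := by
    simpa only [one_pow, ENNReal.ofReal_one] using (hcont.tendsto 1).mono_left nhdsWithin_le_nhds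
  obtain ⟨ρ, hρτ, hρ⟩ :=
    ((hlim.eventually_const_lt hτ).and (Ioo_mem_nhdsLT zero_lt_one)).exists
  exact ⟨ρ, hρ.1, hρ.2, hρτ⟩

lemma LargeSubsetBound.exists_expansion (h : LargeSubsetBound ν μ τ K) (hτ : τ < 1) :
    ∃ s : ℝ≥0, 1 < s ∧ ∀ (c : E) (r : ℝ), 0 < r → ∀ A : Set E, NullMeasurableSet A ν →
      A ⊆ closedBall c r → ν A < τ * ν (closedBall c r) →
        ∃ A' ⊆ closedBall c r, NullMeasurableSet A' ν ∧ s * ν A ≤ ν A' ∧ μ A' ≤ (1 + K) * μ A := by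
  obtain ⟨ρ, hρ0, hρ1, hρτ⟩ := exists_lt_ofReal_pow_of_lt_one (finrank ℝ E) hτ
  set θ : ℝ≥0∞ := τ / ENNReal.ofReal (ρ ^ finrank ℝ E)
  have hθ : θ < 1 := ENNReal.div_lt_of_lt_mul (by rwa [one_mul])
  obtain ⟨s, hs1, hs⟩ := ENNReal.lt_iff_exists_nnreal_btwn.1 <|
    ENNReal.lt_add_right ENNReal.one_ne_top
      (ENNReal.div_pos (tsub_pos_of_lt hθ).ne' (ENNReal.ofReal_ne_top (r := 5 ^ finrank ℝ E))).ne'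
  refine ⟨s, by exact_mod_cast hs1, fun c r hr A hA hAB hsparse => ?_⟩
  obtain ⟨u, hu, hdisj, huB, hge, hle, hcover⟩ :=
    exists_disjoint_closedBalls_density_le hτ hρ0 hρ1 hA hr hAB hsparse
  set V : Set E := ⋃ a ∈ u, closedBall a.1 a.2
  have hVm : MeasurableSet V := .biUnion hu fun _ _ => measurableSet_closedBall
  have hVB : V ⊆ closedBall c r := iUnion₂_subset huB
  have hAV : ν (A ∩ V) ≤ θ * ν V := by
    rw [inter_iUnion₂, measure_biUnion hu hdisj fun _ _ => measurableSet_closedBall,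
      ← ENNReal.tsum_mul_left]
    exact (MeasureTheory.measure_biUnion_le ν hu _).trans
      (ENNReal.tsum_le_tsum fun a => hle a a.2)
  refine ⟨A ∪ V, union_subset hAB hVB, hA.union hVm.nullMeasurableSet, ?_, ?_⟩
  · calc s * ν A ≤ (1 + (1 - θ) / ENNReal.ofReal (5 ^ finrank ℝ E)) * ν A := by gcongr
      _ ≤ ν (A ∪ V) := one_add_mul_measure_le_measure_union hA hAV hcover
        (measure_ne_top_of_subset hVB measure_closedBall_lt_top.ne)
  · calc μ (A ∪ V) ≤ μ A + μ V := measure_union_le _ _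
      _ ≤ μ A + K * μ A := by
        gcongr
        exact (h.measure_biUnion_le hA hu hdisj hge).trans (by gcongr; exact inter_subset_left)
      _ = (1 + K) * μ A := by ring

lemma LargeSubsetBound.exists_iterate (h : LargeSubsetBound ν μ τ K) (hτ : τ < 1) :
    ∃ s : ℝ≥0, 1 < s ∧ ∀ k : ℕ, LargeSubsetBound ν μ (τ * (s⁻¹ : ℝ≥0) ^ k) (K * (1 + K) ^ k) := by
  obtain ⟨s, hs, hexp⟩ := h.exists_expansion hτ
  have hcancel : (s : ℝ≥0∞) * (s⁻¹ : ℝ≥0) = 1 := by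
    rw [← ENNReal.coe_mul, mul_inv_cancel₀ (zero_lt_one.trans hs).ne', ENNReal.coe_one]
  refine ⟨s, hs, fun k => ?_⟩
  induction k with
  | zero => simpa only [pow_zero, mul_one] using h
  | succ k ih =>
    intro c r hr A hA hdense
    have hB : NullMeasurableSet (closedBall c r) ν := measurableSet_closedBall.nullMeasurableSet
    rcases le_or_gt (τ * ν (closedBall c r)) (ν (A ∩ closedBall c r)) with hτA | hτA
    · refine (h c r hr A hA hτA).trans ?_
      gcongr
      exact le_mul_of_one_le_right' (one_le_pow₀ le_self_add)
    obtain ⟨A', hA'B, hA', hνA', hμA'⟩ := hexp c r hr _ (hA.inter hB) inter_subset_right hτA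
    have hdense' : τ * (s⁻¹ : ℝ≥0) ^ k * ν (closedBall c r) ≤ ν (A' ∩ closedBall c r) := by
      rw [inter_eq_left.2 hA'B]
      calc τ * (s⁻¹ : ℝ≥0) ^ k * ν (closedBall c r)
          = s * (s⁻¹ : ℝ≥0) * (τ * (s⁻¹ : ℝ≥0) ^ k * ν (closedBall c r)) := by
            rw [hcancel, one_mul]
        _ = s * (τ * (s⁻¹ : ℝ≥0) ^ (k + 1) * ν (closedBall c r)) := by ring
        _ ≤ s * ν (A ∩ closedBall c r) := by gcongr
        _ ≤ ν A' := hνA'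
    calc μ (closedBall c r)
        ≤ (K * (1 + K) ^ k : ℝ≥0) * μ (A' ∩ closedBall c r) := ih c r hr A' hA' hdense'
      _ ≤ (K * (1 + K) ^ k : ℝ≥0) * ((1 + K) * μ (A ∩ closedBall c r)) := by
          gcongr
          exact (measure_mono inter_subset_left).trans hμA'
      _ = (K * (1 + K) ^ (k + 1) : ℝ≥0) * μ (A ∩ closedBall c r) := by
          push_cast
          ring

end SelfImprovement

section NegativePower

lemma exists_rpow_lt {b s : ℝ≥0} (hs : 1 < s) : ∃ δ : ℝ, 0 < δ ∧ b ^ δ < s := by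
  obtain ⟨t, ht1, hts⟩ := exists_between hs
  obtain ⟨k, hk, hk0⟩ :=
    ((NNReal.eventually_pow_one_div_le b ht1).and (eventually_gt_atTop 0)).exists
  exact ⟨1 / k, by positivity, hk.trans_lt hts⟩

variable {X : Type*} [PseudoMetricSpace X] [MeasurableSpace X] [OpensMeasurableSpace X]
  {ν : Measure X} {w : X → ℝ≥0∞} {τ : ℝ≥0∞} {K : ℝ≥0}

lemma LargeSubsetBound.measure_sublevel_inter_le (hw : AEMeasurable w ν)
    (h : LargeSubsetBound ν (ν.withDensity w) τ K) {c : X} {r : ℝ} (hr : 0 < r)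
    (hν0 : ν (closedBall c r) ≠ 0) (hν : ν (closedBall c r) ≠ ∞)
    (hμ0 : ν.withDensity w (closedBall c r) ≠ 0) (hμ : ν.withDensity w (closedBall c r) ≠ ∞)
    {ε : ℝ≥0∞} (hε : K * ε < 1) :
    ν ({x | w x ≤ ε * (ν.withDensity w (closedBall c r) / ν (closedBall c r))} ∩ closedBall c r) ≤
      τ * ν (closedBall c r) := by
  set B := closedBall c r
  set m := ν.withDensity w B / ν B
  have hA : NullMeasurableSet {x | w x ≤ ε * m} ν := nullMeasurableSet_le hw aemeasurable_const
  have hAB : NullMeasurableSet ({x | w x ≤ ε * m} ∩ B) ν :=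
    hA.inter measurableSet_closedBall.nullMeasurableSet
  have hsmall : ν.withDensity w ({x | w x ≤ ε * m} ∩ B) ≤ ε * ν.withDensity w B :=
    calc ν.withDensity w ({x | w x ≤ ε * m} ∩ B) = ∫⁻ x in {x | w x ≤ ε * m} ∩ B, w x ∂ν :=
          withDensity_apply₀ _ hAB
      _ ≤ ∫⁻ _ in {x | w x ≤ ε * m} ∩ B, ε * m ∂ν :=
          lintegral_mono_ae ((ae_restrict_mem₀ hAB).mono fun x hx => hx.1)
      _ ≤ ε * m * ν B := by
          rw [setLIntegral_const]
          gcongr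
          exact inter_subset_right
      _ = ε * ν.withDensity w B := by rw [mul_assoc, ENNReal.div_mul_cancel hν0 hν]
  by_contra! hdense
  refine lt_irrefl (ν.withDensity w B) ?_
  calc ν.withDensity w B ≤ K * (ε * ν.withDensity w B) :=
        (h c r hr _ hA hdense.le).trans (by gcongr)
    _ = K * ε * ν.withDensity w B := (mul_assoc _ _ _).symm
    _ < 1 * ν.withDensity w B := ENNReal.mul_lt_mul_left hμ0 hμ hε
    _ = ν.withDensity w B := one_mul _

lemma LargeSubsetBound.measure_superlevel_inv_le (hw : AEMeasurable w ν) (hτ : τ ≤ 1) {s : ℝ≥0}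
    (hs : 1 ≤ s)
    (h : ∀ k : ℕ, LargeSubsetBound ν (ν.withDensity w) (τ * (s⁻¹ : ℝ≥0) ^ k) (K * (1 + K) ^ k))
    {c : X} {r : ℝ} (hr : 0 < r)
    (hν0 : ν (closedBall c r) ≠ 0) (hν : ν (closedBall c r) ≠ ∞)
    (hμ0 : ν.withDensity w (closedBall c r) ≠ 0) (hμ : ν.withDensity w (closedBall c r) ≠ ∞)
    (k : ℕ) :
    ν ({x | ((2 + K : ℝ≥0) : ℝ≥0∞) ^ k ≤
        ν.withDensity w (closedBall c r) / ν (closedBall c r) / w x} ∩ closedBall c r) ≤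
      s * ν (closedBall c r) * (s⁻¹ : ℝ≥0) ^ k := by
  set B := closedBall c r
  rcases k with _ | k
  · rw [pow_zero, pow_zero, mul_one]
    calc ν (_ ∩ B) ≤ 1 * ν B := by
          rw [one_mul]
          exact measure_mono inter_subset_right
      _ ≤ s * ν B := by gcongr; exact_mod_cast hs
  set ε : ℝ≥0 := (2 + K)⁻¹ ^ (k + 1)
  have hεβ : (ε : ℝ≥0∞) * ((2 + K : ℝ≥0) : ℝ≥0∞) ^ (k + 1) = 1 := by
    rw [← ENNReal.coe_pow, ← ENNReal.coe_mul, ← mul_pow, inv_mul_cancel₀ (by positivity), one_pow,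
      ENNReal.coe_one]
  have hε : ((K * (1 + K) ^ k : ℝ≥0) : ℝ≥0∞) * ε < 1 := by
    rw [← ENNReal.coe_mul, ENNReal.coe_lt_one_iff, show ε = (2 + K)⁻¹ ^ (k + 1) from rfl, inv_pow,
      ← div_eq_mul_inv, div_lt_one (by positivity), pow_succ']
    calc K * (1 + K) ^ k ≤ K * (2 + K) ^ k := by gcongr; norm_num
      _ < (2 + K) * (2 + K) ^ k := by
        gcongr
        exact lt_add_of_pos_left K two_pos
  have hsub : {x | ((2 + K : ℝ≥0) : ℝ≥0∞) ^ (k + 1) ≤ ν.withDensity w B / ν B / w x} ⊆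
      {x | w x ≤ ε * (ν.withDensity w B / ν B)} := fun x hx =>
    calc w x = ε * (((2 + K : ℝ≥0) : ℝ≥0∞) ^ (k + 1) * w x) := by rw [← mul_assoc, hεβ, one_mul]
      _ ≤ ε * (ν.withDensity w B / ν B) := by
        gcongr
        exact ENNReal.mul_le_of_le_div hx
  calc _ ≤ ν ({x | w x ≤ ε * (ν.withDensity w B / ν B)} ∩ B) := by gcongr
    _ ≤ τ * (s⁻¹ : ℝ≥0) ^ k * ν B :=
        (h k).measure_sublevel_inter_le hw hr hν0 hν hμ0 hμ hε
    _ ≤ 1 * (s⁻¹ : ℝ≥0) ^ k * ν B := by gcongr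
    _ = s * (s⁻¹ : ℝ≥0) * ((s⁻¹ : ℝ≥0) ^ k * ν B) := by
        rw [← ENNReal.coe_mul, mul_inv_cancel₀ (zero_lt_one.trans_le hs).ne', ENNReal.coe_one,
          one_mul, one_mul]
    _ = s * ν B * (s⁻¹ : ℝ≥0) ^ (k + 1) := by ring

end NegativePower

section ReverseHolder

variable {E : Type*} [NormedAddCommGroup E] [NormedSpace ℝ E] [FiniteDimensional ℝ E]
  [MeasurableSpace E] [BorelSpace E] {ν : Measure E} [ν.IsAddHaarMeasure] {τ : ℝ≥0∞} {K : ℝ≥0}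

lemma LargeSubsetBound.exists_lintegral_rpow_le {w : E → ℝ≥0} (hw : AEMeasurable w ν)
    (h : LargeSubsetBound ν (ν.withDensity fun x => w x) τ K) (hτ : τ < 1) :
    ∃ δ : ℝ, 0 < δ ∧ ∃ C : ℝ≥0, ∀ (c : E) (r : ℝ), 0 < r →
      ν.withDensity (fun x => (w x : ℝ≥0∞)) (closedBall c r) ≠ 0 →
      ∫⁻ x in closedBall c r, (ν.withDensity (fun x => (w x : ℝ≥0∞)) (closedBall c r) /
        ν (closedBall c r) / w x) ^ δ ∂ν ≤ C * ν (closedBall c r) := by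
  obtain ⟨s, hs, hiter⟩ := h.exists_iterate hτ
  obtain ⟨δ, hδ, hδs⟩ := exists_rpow_lt (b := 2 + K) hs
  have hβ : 1 < 2 + K := one_lt_two.trans_le le_self_add
  have hratio : ((2 + K : ℝ≥0) : ℝ≥0∞) ^ δ * (s⁻¹ : ℝ≥0) < 1 := by
    rw [← ENNReal.coe_rpow_of_nonneg _ hδ.le, ← ENNReal.coe_mul, ENNReal.coe_lt_one_iff,
      ← div_eq_mul_inv]
    exact (div_lt_one (zero_lt_one.trans hs)).2 hδs
  set β : ℝ≥0∞ := ((2 + K : ℝ≥0) : ℝ≥0∞)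
  set C : ℝ≥0∞ := 1 + β ^ δ * s * (1 - β ^ δ * (s⁻¹ : ℝ≥0))⁻¹
  have hC : C ≠ ∞ := ENNReal.add_ne_top.2 ⟨ENNReal.one_ne_top, ENNReal.mul_ne_top
    (ENNReal.mul_ne_top (ENNReal.rpow_ne_top_of_nonneg hδ.le ENNReal.coe_ne_top)
      ENNReal.coe_ne_top) (ENNReal.inv_ne_top.2 (tsub_pos_of_lt hratio).ne')⟩
  refine ⟨δ, hδ, C.toNNReal, fun c r hr hμ0 => ?_⟩
  have hν0 := (measure_closedBall_pos ν c hr).ne'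
  have hν := (measure_closedBall_lt_top (μ := ν) (x := c) (r := r)).ne
  have hμ := h.measure_closedBall_ne_top hτ hr hν0 hν
  have hwm : AEMeasurable (fun x => (w x : ℝ≥0∞)) ν := hw.coe_nnreal_ennreal
  calc _ ≤ ν.restrict (closedBall c r) univ +
        β ^ δ * (s * ν (closedBall c r)) * (1 - β ^ δ * (s⁻¹ : ℝ≥0))⁻¹ := by
        refine lintegral_rpow_le_of_geometric_decay (hwm.restrict.const_div _) hβ hδ fun k => ?_
        rw [Measure.restrict_apply' measurableSet_closedBall]
        exact LargeSubsetBound.measure_superlevel_inv_le hwm hτ.le hs.le hiter hr hν0 hν hμ0 hμ k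
    _ = C * ν (closedBall c r) := by
        rw [Measure.restrict_apply_univ]
        ring
    _ = _ := by rw [ENNReal.coe_toNNReal hC]

end ReverseHolder

section Muckenhoupt

lemma mul_rpow_le_of_div_mul_div_rpow_le {a b v C : ℝ≥0∞} (hv0 : v ≠ 0) (hv : v ≠ ∞) {q : ℝ}
    (hq : 0 ≤ q - 1) (h : a / v * (b / v) ^ (q - 1) ≤ C) : a * b ^ (q - 1) ≤ C * v ^ q :=
  calc a * b ^ (q - 1) = a / v * v * (b / v * v) ^ (q - 1) := by
        rw [ENNReal.div_mul_cancel hv0 hv, ENNReal.div_mul_cancel hv0 hv]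
    _ = a / v * (b / v) ^ (q - 1) * (v ^ (1 : ℝ) * v ^ (q - 1)) := by
        rw [ENNReal.mul_rpow_of_nonneg _ _ hq, ENNReal.rpow_one]
        ring
    _ = a / v * (b / v) ^ (q - 1) * v ^ q := by
        rw [← ENNReal.rpow_add _ _ hv0 hv, add_sub_cancel]
    _ ≤ C * v ^ q := by gcongr

lemma measure_rpow_le_withDensity_mul {α : Type*} [MeasurableSpace α] {ν : Measure α}
    {w : α → ℝ≥0} (hw : AEMeasurable w ν) {q : ℝ} (hq : 1 < q) {A B : Set α}
    (hA : NullMeasurableSet A ν) (hAB : A ⊆ B)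
    (hσ : ∫⁻ x in B, (w x : ℝ≥0∞) ^ (-1 / (q - 1)) ∂ν ≠ ∞) :
    ν A ^ q ≤ ν.withDensity (fun x => (w x : ℝ≥0∞)) A *
      (∫⁻ x in B, (w x : ℝ≥0∞) ^ (-1 / (q - 1)) ∂ν) ^ (q - 1) := by
  have hσA := lintegral_mono_set (μ := ν) (f := fun x => (w x : ℝ≥0∞) ^ (-1 / (q - 1))) hAB
  rw [← Measure.restrict_apply_univ A, withDensity_apply₀ _ hA]
  refine (measure_univ_rpow_le_lintegral_mul_lintegral_rpow hw.restrict hq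
    (ne_top_of_le_ne_top hσ hσA)).trans ?_
  exact mul_le_mul_right (ENNReal.rpow_le_rpow hσA (by linarith)) _

variable {X : Type*} [PseudoMetricSpace X] [MeasurableSpace X] [OpensMeasurableSpace X]
  {ν : Measure X} {w : X → ℝ≥0}

lemma largeSubsetBound_of_muckenhoupt (hw : AEMeasurable w ν)
    (hν0 : ∀ (c : X) (r : ℝ), 0 < r → ν (closedBall c r) ≠ 0)
    (hν : ∀ (c : X) (r : ℝ), ν (closedBall c r) ≠ ∞) {q : ℝ} (hq : 1 < q) {C : ℝ≥0}
    (hC : ∀ (c : X) (r : ℝ), 0 < r →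
      ν.withDensity (fun x => (w x : ℝ≥0∞)) (closedBall c r) / ν (closedBall c r) *
        ((∫⁻ x in closedBall c r, (w x : ℝ≥0∞) ^ (-1 / (q - 1)) ∂ν) / ν (closedBall c r)) ^
          (q - 1) ≤ C)
    {τ : ℝ≥0} (hτ : 0 < τ) :
    LargeSubsetBound ν (ν.withDensity fun x => w x) τ (C / τ ^ q) := by
  intro c r hr A hA hdense
  specialize hC c r hr
  set μ := ν.withDensity fun x => (w x : ℝ≥0∞)
  set B := closedBall c r
  set σ := ∫⁻ x in B, (w x : ℝ≥0∞) ^ (-1 / (q - 1)) ∂ν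
  have hV0 : ν B ≠ 0 := hν0 c r hr
  have hV : ν B ≠ ∞ := hν c r
  have hq0 : 0 < q := by linarith
  have hq1 : 0 < q - 1 := by linarith
  by_cases hσ : σ = ∞
  · have hμB : μ B = 0 := by
      by_contra hμB
      rw [hσ, ENNReal.top_div_of_ne_top hV, ENNReal.top_rpow_of_pos hq1,
        ENNReal.mul_top (ENNReal.div_ne_zero.2 ⟨hμB, hV⟩)] at hC
      exact ENNReal.coe_ne_top (top_unique hC)
    rw [hμB]
    exact zero_le
  have hHolder : ν (A ∩ B) ^ q ≤ μ (A ∩ B) * σ ^ (q - 1) :=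
    measure_rpow_le_withDensity_mul hw hq (hA.inter measurableSet_closedBall.nullMeasurableSet)
      inter_subset_right hσ
  have hμσ : μ B * σ ^ (q - 1) ≤ C * ν B ^ q :=
    mul_rpow_le_of_div_mul_div_rpow_le hV0 hV hq1.le hC
  have hcancel : μ B * τ ^ q * ν B ^ q ≤ C * μ (A ∩ B) * ν B ^ q :=
    calc μ B * τ ^ q * ν B ^ q = μ B * (τ * ν B) ^ q := by
          rw [ENNReal.mul_rpow_of_nonneg _ _ hq0.le, mul_assoc]
      _ ≤ μ B * (μ (A ∩ B) * σ ^ (q - 1)) := by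
          gcongr
          exact (ENNReal.rpow_le_rpow hdense hq0.le).trans hHolder
      _ = μ B * σ ^ (q - 1) * μ (A ∩ B) := by ring
      _ ≤ C * ν B ^ q * μ (A ∩ B) := by gcongr
      _ = C * μ (A ∩ B) * ν B ^ q := by ring
  have hτq : τ ^ q ≠ 0 := (NNReal.rpow_pos hτ).ne'
  rw [ENNReal.coe_div hτq, ← ENNReal.mul_div_right_comm, ENNReal.le_div_iff_mul_le
    (.inl (by exact_mod_cast hτq)) (.inl ENNReal.coe_ne_top), ENNReal.coe_rpow_of_nonneg _ hq0.le]
  exact (ENNReal.mul_le_mul_iff_left (ENNReal.rpow_pos hV0.bot_lt hV).ne'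
    (ENNReal.rpow_ne_top_of_nonneg hq0.le hV)).1 hcancel

end Muckenhoupt

variable {n : ℕ}

section AInfty

variable {w : (Fin n → ℝ) → ℝ≥0}

lemma closedBall_pi_eq_Icc (c : Fin n → ℝ) {r : ℝ} (hr : 0 ≤ r) :
    closedBall c r = Icc (fun i => c i - r) (fun i => c i + r) := by
  simp only [closedBall_pi c hr, ← pi_univ_Icc, Real.closedBall_eq_Icc]

lemma isCube_iff {Q : Set (Fin n → ℝ)} :
    IsCube Q ↔ ∃ (c : Fin n → ℝ) (r : ℝ), 0 < r ∧ Q = closedBall c r := by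
  constructor
  · rintro ⟨a, l, hl, rfl⟩
    refine ⟨fun i => a i + l / 2, l / 2, half_pos hl, ?_⟩
    rw [closedBall_pi_eq_Icc _ (half_pos hl).le]
    congr 1 <;> funext i <;> ring
  · rintro ⟨c, r, hr, rfl⟩
    refine ⟨fun i => c i - r, 2 * r, by positivity, ?_⟩
    rw [closedBall_pi_eq_Icc _ hr.le]
    congr 1
    funext i
    ring

lemma isCube_closedBall (c : Fin n → ℝ) {r : ℝ} (hr : 0 < r) : IsCube (closedBall c r) :=
  isCube_iff.2 ⟨c, r, hr, rfl⟩

lemma ApConst_le_A1Const {q : ℝ} (hq : 1 < q) (w : (Fin n → ℝ) → ℝ≥0) :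
    ApConst q w ≤ A1Const w := by
  have hq1 : 0 < q - 1 := by linarith
  refine iSup₂_mono fun Q _ => mul_le_mul_right ?_ _
  set M := essSup (fun x => (w x : ℝ≥0∞)⁻¹) (volume.restrict Q)
  have hint : ∫⁻ x in Q, (w x : ℝ≥0∞) ^ (-1 / (q - 1)) ≤ M ^ (1 / (q - 1)) * volume Q := by
    rw [← setLIntegral_const]
    refine lintegral_mono_ae ?_
    filter_upwards [ENNReal.ae_le_essSup (μ := volume.restrict Q) fun x => (w x : ℝ≥0∞)⁻¹]
      with x hx
    rw [neg_div, ENNReal.rpow_neg, ← ENNReal.inv_rpow]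
    gcongr
  calc _ ≤ (M ^ (1 / (q - 1))) ^ (q - 1) := by
        gcongr
        exact ENNReal.div_le_of_le_mul hint
    _ = M := by rw [← ENNReal.rpow_mul, one_div_mul_cancel hq1.ne', ENNReal.rpow_one]

lemma isAInfty_iff : IsAInfty w ↔ ∃ q : ℝ, 1 < q ∧ ApConst q w < ∞ := by
  refine ⟨?_, fun ⟨q, hq⟩ => ⟨q, .inr hq⟩⟩
  rintro ⟨q, ⟨-, h⟩ | hq⟩
  · exact ⟨2, one_lt_two, (ApConst_le_A1Const one_lt_two w).trans_lt h⟩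
  · exact ⟨q, hq⟩

lemma IsAInfty.exists_largeSubsetBound (hw : AEMeasurable w volume) (h : IsAInfty w) {τ : ℝ≥0}
    (hτ : 0 < τ) : ∃ K, LargeSubsetBound volume (weightMeasure w) τ K := by
  obtain ⟨q, hq, hfin⟩ := isAInfty_iff.1 h
  refine ⟨_, largeSubsetBound_of_muckenhoupt hw
    (fun c r hr => (measure_closedBall_pos volume c hr).ne')
    (fun c r => measure_closedBall_lt_top.ne) hq (C := (ApConst q w).toNNReal)
    (fun c r hr => ?_) hτ⟩
  rw [ENNReal.coe_toNNReal hfin.ne]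
  exact le_iSup₂_of_le (closedBall c r) (isCube_closedBall c hr) le_rfl

lemma LargeSubsetBound.isAInfty (hw : AEMeasurable w volume) {τ : ℝ≥0∞} {K : ℝ≥0}
    (h : LargeSubsetBound volume (weightMeasure w) τ K) (hτ : τ < 1) : IsAInfty w := by
  obtain ⟨δ, hδ, C, hC⟩ := h.exists_lintegral_rpow_le hw hτ
  have hδ' : 0 < 1 / δ := one_div_pos.2 hδ
  refine isAInfty_iff.2 ⟨1 + 1 / δ, by linarith,
    lt_of_le_of_lt (iSup₂_le fun Q hQ => ?_)
      (ENNReal.rpow_lt_top_of_nonneg hδ'.le (ENNReal.coe_ne_top (r := C)))⟩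
  obtain ⟨c, r, hr, rfl⟩ := isCube_iff.1 hQ
  have hexp : -1 / (1 + 1 / δ - 1) = -δ := by field_simp; ring
  rw [hexp, add_sub_cancel_left]
  set B := closedBall c r
  set m := weightMeasure w B / volume B
  rcases eq_or_ne (weightMeasure w B) 0 with hμ0 | hμ0
  · simp [m, hμ0]
  have hσ : m ^ δ * ∫⁻ x in B, (w x : ℝ≥0∞) ^ (-δ) ≤ C * volume B :=
    calc m ^ δ * ∫⁻ x in B, (w x : ℝ≥0∞) ^ (-δ) = ∫⁻ x in B, (m / w x) ^ δ := by
          rw [← lintegral_const_mul'' _ (hw.coe_nnreal_ennreal.restrict.pow_const _)]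
          simp only [div_eq_mul_inv, ENNReal.mul_rpow_of_nonneg _ _ hδ.le, ENNReal.inv_rpow,
            ENNReal.rpow_neg]
      _ ≤ C * volume B := hC c r hr hμ0
  calc m * ((∫⁻ x in B, (w x : ℝ≥0∞) ^ (-δ)) / volume B) ^ (1 / δ)
      = (m ^ δ * (∫⁻ x in B, (w x : ℝ≥0∞) ^ (-δ)) / volume B) ^ (1 / δ) := by
        rw [mul_div_assoc, ENNReal.mul_rpow_of_nonneg _ _ hδ'.le, ← ENNReal.rpow_mul,
          mul_one_div_cancel hδ.ne', ENNReal.rpow_one]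
    _ ≤ (C : ℝ≥0∞) ^ (1 / δ) := by
        gcongr
        exact ENNReal.div_le_of_le_mul hσ

end AInfty

section MaximalOperator

variable {w : (Fin n → ℝ) → ℝ≥0} {f : (Fin n → ℝ) → ℝ} {τ p : ℝ}

lemma lt_levelMaximal_iff {x : Fin n → ℝ} {a : ℝ≥0∞} :
    a < levelMaximal τ f x ↔
      ∃ c r, 0 < r ∧ x ∈ closedBall c r ∧ a < level τ f (closedBall c r) := by
  simp only [levelMaximal, lt_iSup_iff, isCube_iff]
  constructor
  · rintro ⟨_, ⟨c, r, hr, rfl⟩, hx, h⟩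
    exact ⟨c, r, hr, hx, h⟩
  · rintro ⟨c, r, hr, hx, h⟩
    exact ⟨_, ⟨c, r, hr, rfl⟩, hx, h⟩

lemma aemeasurable_levelMaximal (τ : ℝ) (f : (Fin n → ℝ) → ℝ) :
    AEMeasurable (levelMaximal τ f) volume := by
  refine NullMeasurable.aemeasurable <|
    measurable_of_Ioi (δ := NullMeasurableSpace (Fin n → ℝ) volume) fun a => ?_
  have hunion : levelMaximal τ f ⁻¹' Ioi a =
      ⋃ b ∈ {b : (Fin n → ℝ) × ℝ | 0 < b.2 ∧ a < level τ f (closedBall b.1 b.2)},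
        closedBall b.1 b.2 := by
    ext x
    simp only [mem_preimage, mem_Ioi, lt_levelMaximal_iff, mem_iUnion, Prod.exists,
      mem_ofPred_eq, exists_prop, and_assoc, and_comm]
  change NullMeasurableSet (levelMaximal τ f ⁻¹' Ioi a) volume
  rw [hunion]
  exact nullMeasurableSet_biUnion_closedBall volume fun b hb => hb.1

lemma setOf_lt_levelMaximal_subset (τ : ℝ) (f : (Fin n → ℝ) → ℝ) (a : ℝ≥0∞) :
    {x | a < levelMaximal τ f x} ⊆
      denseBallUnion volume (ENNReal.ofReal τ) {x | a < ‖f x‖ₑ} := by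
  intro x hx
  obtain ⟨c, r, hr, hxB, hlevel⟩ := lt_levelMaximal_iff.1 hx
  obtain ⟨α, hdense, haα⟩ : ∃ α : ℝ≥0, ∃ _ : ENNReal.ofReal τ ≤
      volume (closedBall c r ∩ {x | (α : ℝ) ≤ |f x|}) / volume (closedBall c r), a < α := by
    simpa only [level, lt_iSup_iff] using hlevel
  refine ⟨c, r, hr, hxB, (ENNReal.mul_le_of_le_div hdense).trans (measure_mono fun y hy => ?_)⟩
  have hαf : (α : ℝ≥0∞) ≤ ‖f y‖ₑ := by
    rw [enorm_eq_nnnorm]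
    exact_mod_cast hy.2
  exact ⟨haα.trans_le hαf, hy.1⟩

lemma IsAInfty.boundedOnLp (hw : AEMeasurable w volume) (h : IsAInfty w) (hτ : 0 < τ)
    (hp : 0 < p) : BoundedOnLp τ p w := by
  obtain ⟨K, hK⟩ := h.exists_largeSubsetBound hw (Real.toNNReal_pos.2 hτ)
  obtain ⟨D, hD⟩ := h.exists_largeSubsetBound hw
    (τ := (5 ^ finrank ℝ (Fin n → ℝ))⁻¹) (by positivity)
  have hac : weightMeasure w ≪ volume := withDensity_absolutelyContinuous _ _
  have hp0 : ENNReal.ofReal p ≠ 0 := (ENNReal.ofReal_pos.2 hp).ne'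
  refine ⟨(D * K) ^ (1 / (ENNReal.ofReal p).toReal), fun f hf hfin => ?_⟩
  have hM : AEMeasurable (levelMaximal τ f) (weightMeasure w) :=
    (aemeasurable_levelMaximal τ f).mono_ac hac
  have hnorm : eLpNorm (levelMaximal τ f) (ENNReal.ofReal p) (weightMeasure w) ≤ _ :=
    eLpNorm_le_mul_of_meas_lt_enorm_le (hf.mono_ac hac).enorm hM.enorm hp0 ENNReal.ofReal_ne_top
      fun a => (measure_mono (setOf_lt_levelMaximal_subset τ f a)).trans <|
        hK.measure_denseBallUnion_le (fun c r hr => hD.measure_closedBall_five_mul_le c hr)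
          (nullMeasurableSet_lt aemeasurable_const hf.enorm)
  exact ⟨⟨hM.aestronglyMeasurable, hnorm.trans_lt (ENNReal.mul_lt_top ENNReal.coe_lt_top hfin)⟩,
    hnorm⟩

lemma one_le_levelMaximal_indicator {A : Set (Fin n → ℝ)} {c : Fin n → ℝ} {r : ℝ} (hr : 0 < r)
    (hdense : ENNReal.ofReal τ * volume (closedBall c r) ≤ volume (A ∩ closedBall c r))
    {x : Fin n → ℝ} (hx : x ∈ closedBall c r) :
    1 ≤ levelMaximal τ ((A ∩ closedBall c r).indicator fun _ => (1 : ℝ)) x := by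
  refine le_iSup₂_of_le (closedBall c r) (isCube_closedBall c hr) (le_iSup_of_le hx ?_)
  refine le_iSup₂_of_le (1 : ℝ≥0) ?_ ENNReal.coe_one.ge
  rw [ENNReal.le_div_iff_mul_le (.inl (measure_closedBall_pos volume c hr).ne')
    (.inl measure_closedBall_lt_top.ne)]
  refine hdense.trans (measure_mono fun y hy => ⟨hy.2, ?_⟩)
  rw [mem_ofPred_eq, indicator_of_mem hy, abs_one, NNReal.coe_one]

lemma BoundedOnLp.exists_largeSubsetBound (hp : 0 < p) (h : BoundedOnLp τ p w) :
    ∃ K, LargeSubsetBound volume (weightMeasure w) (ENNReal.ofReal τ) K := by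
  obtain ⟨C, hC⟩ := h
  have hac : weightMeasure w ≪ volume := withDensity_absolutelyContinuous _ _
  have hp0 : ENNReal.ofReal p ≠ 0 := (ENNReal.ofReal_pos.2 hp).ne'
  -- The summand `1` only matters when `A ∩ B` has infinite weight, because `0 * ∞ = 0`.
  refine ⟨C ^ p + 1, fun c r hr A hA hdense => ?_⟩
  set B := closedBall c r
  have hAB : NullMeasurableSet (A ∩ B) volume := hA.inter measurableSet_closedBall.nullMeasurableSet
  rcases eq_or_ne (weightMeasure w (A ∩ B)) ∞ with htop | hfin
  · rw [htop, ENNReal.mul_top (by simp)]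
    exact le_top
  have hnormAB : eLpNorm ((A ∩ B).indicator fun _ => (1 : ℝ)) (ENNReal.ofReal p) (weightMeasure w)
      = weightMeasure w (A ∩ B) ^ (1 / p) := by
    rw [eLpNorm_indicator_const₀ (hAB.mono_ac hac) hp0 ENNReal.ofReal_ne_top,
      ENNReal.toReal_ofReal hp.le, enorm_one, one_mul]
  have hnormB : eLpNorm (B.indicator fun _ => (1 : ℝ≥0∞)) (ENNReal.ofReal p) (weightMeasure w)
      = weightMeasure w B ^ (1 / p) := by
    rw [eLpNorm_indicator_const measurableSet_closedBall hp0 ENNReal.ofReal_ne_top,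
      ENNReal.toReal_ofReal hp.le, enorm_eq_self, one_mul]
  have hnorm : weightMeasure w B ^ (1 / p) ≤ C * weightMeasure w (A ∩ B) ^ (1 / p) := by
    rw [← hnormAB, ← hnormB]
    refine (eLpNorm_mono_enorm fun x => ?_).trans
      (hC _ (aemeasurable_const.indicator₀ hAB) ?_).2
    · exact indicator_le (fun x hx => one_le_levelMaximal_indicator hr hdense hx) x
    · rw [hnormAB]
      exact ENNReal.rpow_lt_top_of_nonneg (by positivity) hfin
  calc weightMeasure w B = (weightMeasure w B ^ (1 / p)) ^ p := by
        rw [← ENNReal.rpow_mul, one_div_mul_cancel hp.ne', ENNReal.rpow_one]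
    _ ≤ (C * weightMeasure w (A ∩ B) ^ (1 / p)) ^ p := by gcongr
    _ = (C ^ p : ℝ≥0) * weightMeasure w (A ∩ B) := by
        rw [ENNReal.mul_rpow_of_nonneg _ _ hp.le, ← ENNReal.rpow_mul, one_div_mul_cancel hp.ne',
          ENNReal.rpow_one, ENNReal.coe_rpow_of_nonneg _ hp.le]
    _ ≤ (C ^ p + 1 : ℝ≥0) * weightMeasure w (A ∩ B) := by
        gcongr
        exact le_self_add

end MaximalOperator

end MedianMaximal

theorem mainTheorem2 (n : ℕ) (hn : 1 ≤ n) (τ : ℝ) (hτ : τ ∈ Set.Ioo (0 : ℝ) 1)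
    (p : ℝ) (hp : 0 < p) (w : (Fin n → ℝ) → ℝ≥0) (hw : AEMeasurable w volume) :
    MedianMaximal.BoundedOnLp τ p w ↔ MedianMaximal.IsAInfty w := by
  refine ⟨fun h => ?_, fun h => h.boundedOnLp hw hτ.1 hp⟩
  obtain ⟨K, hK⟩ := h.exists_largeSubsetBound hp
  exact hK.isAInfty hw (ENNReal.ofReal_lt_one.2 hτ.2)
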